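/- Let $p$ be an odd prime. For an integer $s\ge 0$ let $T_s(z_1,z_2,z_3)\in\mathbb Z[z_1,z_2,z_3]$ be the coefficient of $t^{p^s-1}$ in the master polynomial $$\Phi_s(t,z)=\big((t-z_1)(t-z_2)(t-z_3)\big)^{(p^s-1)/2},$$ put $\bar T_s=(-1)^{(p^s-1)/2}T_s$, and let $$\mathfrak D=\{z=(z_1,z_2,z_3)\in\mathbb Z_p^3 \;:\; |\bar T_1(z)|_p=1\}.$$ For $i\in\{1,2,3\}$ and $s\ge 1$ let $$\eta^{(i)}_s(z)=\frac{\partial T_s}{\partial z_i}(z)\Big/T_s(z).$$ Then $T_s(z)\neq 0$ for all $s\ge1$ and all $z\in\mathfrak D$ (so that the $\eta_s^{(i)}$ are defined on $\mathfrak D$), for each $i$ the sequence $(\eta_s^{(i)})_{s\ge1}$ converges uniformly on $\mathfrak D$ in the $p$-adic metric to a function $\eta^{(i)}:\mathfrak D\to\mathbb Q_p$, and the vector $$\vec\eta(z)=\big(\eta^{(1)}(z),\eta^{(2)}(z),\eta^{(3)}(z)\big)$$ is nonzero at every point $z\in\mathfrak D$. -/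

import Mathlib

open Filter Topology

/-- The master polynomial `Φ_s(t, z) = ((t - z₁)(t - z₂)(t - z₃)) ^ ((p ^ s - 1) / 2)`, as a
polynomial in `t` over `ℤ[z₁, z₂, z₃]`. The variables `z₁, z₂, z₃` are indexed by `Fin 3`. For odd
`p` the natural-number division and subtraction in the exponent are exact. -/
noncomputable def masterPoly (p s : ℕ) : Polynomial (MvPolynomial (Fin 3) ℤ) :=
  (∏ i : Fin 3, (Polynomial.X - Polynomial.C (MvPolynomial.X i))) ^ ((p ^ s - 1) / 2)

/-- `T_s(z)`: the coefficient of `t ^ (p ^ s - 1)` in the master polynomial `Φ_s(t, z)`. -/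
noncomputable def approxPoly (p s : ℕ) : MvPolynomial (Fin 3) ℤ :=
  (masterPoly p s).coeff (p ^ s - 1)

/-- The normalized polynomial `(-1) ^ ((p ^ s - 1) / 2) * T_s(z)`. -/
noncomputable def approxPolyBar (p s : ℕ) : MvPolynomial (Fin 3) ℤ :=
  (-1) ^ ((p ^ s - 1) / 2) * approxPoly p s

/-- The domain `𝔇` of all `z ∈ ℤ_p³` at which the normalized polynomial with `s = 1` has
`p`-adic absolute value `1`. -/
def domainD (p : ℕ) [Fact p.Prime] : Set (Fin 3 → ℤ_[p]) :=
  {z | ‖MvPolynomial.aeval z (approxPolyBar p 1)‖ = 1}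

/-- The value at `z` of the rational function `η_s^{(i)} = (∂T_s/∂z_i) / T_s`. -/
noncomputable def etaApprox (p : ℕ) [Fact p.Prime] (s : ℕ) (i : Fin 3) (z : Fin 3 → ℤ_[p]) :
    ℚ_[p] :=
  ((MvPolynomial.aeval z (MvPolynomial.pderiv i (approxPoly p s)) : ℤ_[p]) : ℚ_[p]) /
    ((MvPolynomial.aeval z (approxPoly p s) : ℤ_[p]) : ℚ_[p])

/-- The vector `η(z) = (η^{(1)}(z), η^{(2)}(z), η^{(3)}(z))`, where `η^{(i)}(z)` is the `p`-adic
limit of `η_s^{(i)}(z)` as `s → ∞`. -/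
noncomputable def etaVec (p : ℕ) [Fact p.Prime] (z : Fin 3 → ℤ_[p]) : Fin 3 → ℚ_[p] :=
  fun i => limUnder atTop (fun s : ℕ => etaApprox p s i z)

/-! This is a Dwork-type congruence argument. The master polynomials expand as `Φ_{s+1} = ∑ J_k ·
Φ_{s-k}(t^{p^(k+1)}, z^{p^(k+1)})`, with `p^k ∣ J_k` (`pow_dvd_ghost`). The degree of `J_k` in `t`
is small enough that taking coefficients respects each product, so `T_{s+1}(z) = ∑ I_k(z)
T_{s-k}(z^{p^(k+1)})` with `p^k ∣ I_k` (`approxPoly_succ`).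

Modulo `p` only `k = 0` survives, so `T_s` is a unit on `𝔇` by induction. Higher powers of `p`
control the ratios `T_s(z^{p^k}) / T_{s+k}(z)` (`pow_dvd_approxRatio_sub`). Differentiating the
expansion then gives `η_{s+1} ≡ η_s` modulo `p^s`, hence uniform convergence.

Nonvanishing is Euler's identity: `T_s` is homogeneous of degree `(p^s - 1)/2`, so `2 ∑ z_i
η_s^{(i)} = p^s - 1`, which tends to `-1`. -/

section Frobenius

variable {σ : Type*}

/-- The endomorphism `t ↦ t ^ q`, `zᵢ ↦ zᵢ ^ q` of `ℤ[z][t]`. -/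
noncomputable def frobLift (q : ℕ) :
    Polynomial (MvPolynomial σ ℤ) →+* Polynomial (MvPolynomial σ ℤ) :=
  (Polynomial.expand (MvPolynomial σ ℤ) q).toRingHom.comp
    (Polynomial.mapRingHom (MvPolynomial.expand q : MvPolynomial σ ℤ →ₐ[ℤ] _).toRingHom)

theorem frobLift_apply (q : ℕ) (f : Polynomial (MvPolynomial σ ℤ)) :
    frobLift q f = Polynomial.expand _ q
      (f.map (MvPolynomial.expand q : MvPolynomial σ ℤ →ₐ[ℤ] _).toRingHom) := rfl

theorem frobLift_X_sub_C (q : ℕ) (i : σ) :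
    frobLift q (Polynomial.X - Polynomial.C (MvPolynomial.X i)) =
      Polynomial.X ^ q - Polynomial.C (MvPolynomial.X i) ^ q := by
  simp [frobLift_apply]

theorem natDegree_frobLift_le (q : ℕ) (f : Polynomial (MvPolynomial σ ℤ)) :
    (frobLift q f).natDegree ≤ f.natDegree * q := by
  rw [frobLift_apply, Polynomial.natDegree_expand]
  exact Nat.mul_le_mul_right q (Polynomial.natDegree_map_le)

end Frobenius

/-! ### Congruences and coefficient extraction. -/

theorem Odd.dvd_sub_pow_prime_pow_sub {R : Type*} [CommRing R] {p : ℕ} (hp : p.Prime)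
    (hodd : Odd p) (x y : R) (n : ℕ) :
    (p : R) ∣ (x - y) ^ p ^ n - (x ^ p ^ n - y ^ p ^ n) := by
  obtain ⟨r, hr⟩ := exists_add_pow_prime_pow_eq hp x (-y) n
  rw [(hodd.pow).neg_pow] at hr
  rw [sub_eq_add_neg x y, hr]
  exact ⟨x * -y * r, by ring⟩

theorem Finset.dvd_prod_sub_prod {R ι : Type*} [CommRing R] {a : R} (s : Finset ι) {f g : ι → R}
    (h : ∀ i ∈ s, a ∣ f i - g i) : a ∣ ∏ i ∈ s, f i - ∏ i ∈ s, g i := by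
  simp only [← Ideal.mem_span_singleton, ← Ideal.Quotient.eq, map_prod] at h ⊢
  exact Finset.prod_congr rfl h

/-- A contributing exponent of `A` is congruent to `-1` modulo `q` and at most `2q - 2`, hence
equals `q - 1`. -/
theorem Polynomial.coeff_mul_expand_of_natDegree_lt {R : Type*} [CommSemiring R] {q : ℕ}
    (hq : 0 < q) (A B : Polynomial R) (hA : A.natDegree < 2 * q - 1) (n : ℕ) :
    (A * Polynomial.expand R q B).coeff (q * (n + 1) - 1) = A.coeff (q - 1) * B.coeff n := by
  rw [Polynomial.coeff_mul, Finset.sum_eq_single (q - 1, q * n)]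
  · simp [Polynomial.coeff_expand_mul' hq]
  · rintro ⟨a, b⟩ hab hne
    rw [Finset.HasAntidiagonal.mem_antidiagonal] at hab
    simp only at hab ⊢
    by_cases ha : A.natDegree < a
    · rw [Polynomial.coeff_eq_zero_of_natDegree_lt ha, zero_mul]
    by_cases hb : q ∣ b
    · exfalso
      obtain ⟨m, rfl⟩ := hb
      apply hne
      have h1 : m ≤ n := by
        by_contra! hlt
        have := Nat.mul_le_mul_left q (Nat.succ_le_of_lt hlt)
        simp only [Nat.succ_eq_add_one, mul_add, mul_one] at *
        omega
      have h2 : n ≤ m := by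
        by_contra! hlt
        have := Nat.mul_le_mul_left q (Nat.succ_le_of_lt hlt)
        simp only [Nat.succ_eq_add_one, mul_add, mul_one] at *
        omega
      obtain rfl := le_antisymm h1 h2
      simp only [Prod.mk.injEq, and_true]
      simp only [mul_add, mul_one] at hab
      omega
    · rw [Polynomial.coeff_expand hq, if_neg hb, mul_zero]
  · intro h
    exfalso
    apply h
    rw [Finset.HasAntidiagonal.mem_antidiagonal]
    simp only [mul_add, mul_one]
    omega

/-! ### Ghost expansion of the master polynomials. -/

section Ghost

variable {p : ℕ}

theorem two_mul_exponent_add_one (hodd : Odd p) (s : ℕ) : 2 * ((p ^ s - 1) / 2) + 1 = p ^ s := by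
  obtain ⟨m, hm⟩ := hodd.pow (n := s)
  omega

theorem exponent_add (hodd : Odd p) (a b : ℕ) :
    (p ^ (a + b) - 1) / 2 = (p ^ a - 1) / 2 + p ^ a * ((p ^ b - 1) / 2) := by
  have h1 := two_mul_exponent_add_one hodd (a + b)
  have h2 := two_mul_exponent_add_one hodd a
  have h3 := two_mul_exponent_add_one hodd b
  rw [pow_add] at h1
  have h4 : p ^ a * (2 * ((p ^ b - 1) / 2) + 1) = p ^ a * p ^ b := by rw [h3]
  rw [pow_add]
  rw [mul_add, mul_left_comm] at h4
  omega

/-- The product `(t - z₁)(t - z₂)(t - z₃)`. -/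
noncomputable def rootProd : Polynomial (MvPolynomial (Fin 3) ℤ) :=
  ∏ i : Fin 3, (Polynomial.X - Polynomial.C (MvPolynomial.X i))

theorem masterPoly_eq (p s : ℕ) : masterPoly p s = rootProd ^ ((p ^ s - 1) / 2) := rfl

theorem masterPoly_zero (p : ℕ) : masterPoly p 0 = 1 := by simp [masterPoly]

theorem masterPoly_succ (hodd : Odd p) (s : ℕ) :
    masterPoly p (s + 1) = masterPoly p s * (rootProd ^ p ^ s) ^ ((p - 1) / 2) := by
  rw [masterPoly_eq, masterPoly_eq, exponent_add hodd, pow_add, ← pow_mul, pow_one]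

theorem natDegree_rootProd_le : rootProd.natDegree ≤ 3 := by
  refine (Polynomial.natDegree_prod_le _ _).trans ?_
  refine (Finset.sum_le_sum (g := fun _ => 1) fun i _ => Polynomial.natDegree_X_sub_C_le _).trans ?_
  simp

theorem natDegree_masterPoly_le (p s : ℕ) :
    (masterPoly p s).natDegree ≤ 3 * ((p ^ s - 1) / 2) := by
  rw [masterPoly_eq, mul_comm]
  exact Polynomial.natDegree_pow_le_of_le _ natDegree_rootProd_le

theorem dvd_rootProd_pow_sub_frobLift (hp : p.Prime) (hodd : Odd p) (k : ℕ) :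
    (p : Polynomial (MvPolynomial (Fin 3) ℤ)) ∣
      rootProd ^ p ^ k - frobLift (p ^ k) rootProd := by
  rw [rootProd, ← Finset.prod_pow, map_prod]
  refine Finset.dvd_prod_sub_prod _ fun i _ => ?_
  rw [frobLift_X_sub_C]
  exact hodd.dvd_sub_pow_prime_pow_sub hp _ _ _

/-- Raising a congruence modulo `p` to the power `p^m` improves it to one modulo `p^(m+1)`. -/
theorem pow_dvd_rootProd_pow_sub_frobLift (hp : p.Prime) (hodd : Odd p) (k m e : ℕ) :
    (p : Polynomial (MvPolynomial (Fin 3) ℤ)) ^ (m + 1) ∣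
      (rootProd ^ p ^ (k + m)) ^ e - frobLift (p ^ k) ((rootProd ^ p ^ m) ^ e) := by
  rw [map_pow, map_pow, pow_add p k m, pow_mul rootProd]
  exact (dvd_sub_pow_of_dvd_sub (dvd_rootProd_pow_sub_frobLift hp hodd k) m).trans
    (sub_dvd_pow_sub_pow _ _ _)

/-- The ghost terms `J_k` of the master polynomials, determined by
`Φ_{s+1} = ∑_{k ≤ s} J_k(t, z) Φ_{s-k}(t ^ p ^ (k+1), z ^ p ^ (k+1))`. -/
noncomputable def ghost (p : ℕ) : ℕ → Polynomial (MvPolynomial (Fin 3) ℤ)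
  | s => masterPoly p (s + 1) -
      ∑ k : Fin s, ghost p k * frobLift (p ^ (k + 1 : ℕ)) (masterPoly p (s - k))

theorem ghost_eq (p s : ℕ) : ghost p s = masterPoly p (s + 1) -
    ∑ k ∈ Finset.range s, ghost p k * frobLift (p ^ (k + 1)) (masterPoly p (s - k)) := by
  rw [ghost, Finset.sum_range]

theorem masterPoly_succ_eq_sum_ghost (p s : ℕ) : masterPoly p (s + 1) =
    ∑ k ∈ Finset.range (s + 1), ghost p k * frobLift (p ^ (k + 1)) (masterPoly p (s - k)) := by
  rw [Finset.sum_range_succ, ghost_eq p s, Nat.sub_self, masterPoly_zero, map_one, mul_one]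
  ring

theorem pow_dvd_ghost (hp : p.Prime) (hodd : Odd p) (s : ℕ) :
    (p : Polynomial (MvPolynomial (Fin 3) ℤ)) ^ s ∣ ghost p s := by
  induction s using Nat.strong_induction_on with
  | _ s ih =>
    cases s with
    | zero => simp
    | succ s =>
      -- Both terms are written over the same `J_k · Φ_{s-k}(t^{p^(k+1)}, z^{p^(k+1)})`. The
      -- leftover factor is a Frobenius difference divisible by `p^(s-k+1)`, which complements `p^k
      -- ∣ J_k`.
      rw [ghost_eq, masterPoly_succ hodd, masterPoly_succ_eq_sum_ghost p s, Finset.sum_mul,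
        ← Finset.sum_sub_distrib]
      refine Finset.dvd_sum fun k hk => ?_
      obtain ⟨m, rfl⟩ := Nat.exists_eq_add_of_le (Nat.lt_succ_iff.1 (Finset.mem_range.1 hk))
      have e1 : k + m - k = m := by omega
      have e2 : k + m + 1 - k = m + 1 := by omega
      rw [e1, e2, masterPoly_succ hodd, map_mul, ← mul_assoc, ← mul_sub, add_assoc, pow_add,
        show k + (m + 1) = (k + 1) + m by ring]
      exact mul_dvd_mul ((ih k (by omega)).mul_right _)
        (pow_dvd_rootProd_pow_sub_frobLift hp hodd _ _ _)

theorem natDegree_ghost_le (hodd : Odd p) (s : ℕ) :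
    (ghost p s).natDegree ≤ 3 * ((p ^ (s + 1) - 1) / 2) := by
  induction s using Nat.strong_induction_on with
  | _ s ih =>
    rw [ghost_eq]
    refine (Polynomial.natDegree_sub_le _ _).trans (max_le (natDegree_masterPoly_le _ _) ?_)
    refine Polynomial.natDegree_sum_le_of_forall_le _ _ fun k hk => ?_
    have hk := Finset.mem_range.1 hk
    refine Polynomial.natDegree_mul_le.trans ?_
    refine (add_le_add (ih k hk) ((natDegree_frobLift_le _ _).trans
      (Nat.mul_le_mul_right _ (natDegree_masterPoly_le _ _)))).trans ?_
    rw [show s + 1 = (k + 1) + (s - k) by omega, exponent_add hodd (k + 1)]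
    exact le_of_eq (by ring)

/-- The coefficients `I_k` of the ghost decomposition of the polynomials `T_s`. -/
noncomputable def ghostCoeff (p k : ℕ) : MvPolynomial (Fin 3) ℤ :=
  (ghost p k).coeff (p ^ (k + 1) - 1)

theorem pow_dvd_ghostCoeff (hp : p.Prime) (hodd : Odd p) (k : ℕ) :
    (p : MvPolynomial (Fin 3) ℤ) ^ k ∣ ghostCoeff p k := by
  have h := pow_dvd_ghost hp hodd k
  rw [← map_natCast Polynomial.C, ← map_pow, Polynomial.C_dvd_iff_dvd_coeff] at h
  exact h _

theorem approxPoly_zero (p : ℕ) : approxPoly p 0 = 1 := by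
  simp [approxPoly, masterPoly_zero]

theorem approxPoly_succ (hp : p.Prime) (hodd : Odd p) (s : ℕ) : approxPoly p (s + 1) =
    ∑ k ∈ Finset.range (s + 1),
      ghostCoeff p k * MvPolynomial.expand (p ^ (k + 1)) (approxPoly p (s - k)) := by
  rw [approxPoly, masterPoly_succ_eq_sum_ghost, Polynomial.finsetSum_coeff]
  refine Finset.sum_congr rfl fun k hk => ?_
  have hk := Finset.mem_range.1 hk
  have hpos : 0 < p ^ (s - k) := pow_pos hp.pos _
  -- With `q = p^(k+1)`, the bound is `3(q - 1)/2 < 2q - 1`.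
  have hdeg : (ghost p k).natDegree < 2 * p ^ (k + 1) - 1 := by
    have h1 := natDegree_ghost_le hodd k
    have h2 := two_mul_exponent_add_one hodd (k + 1)
    have h3 : 1 < p ^ (k + 1) := Nat.one_lt_pow (by omega) hp.one_lt
    omega
  have e : p ^ (s + 1) - 1 = p ^ (k + 1) * (p ^ (s - k) - 1 + 1) - 1 := by
    rw [Nat.sub_add_cancel hpos, ← pow_add]
    congr 2
    omega
  rw [frobLift_apply, e, Polynomial.coeff_mul_expand_of_natDegree_lt (pow_pos hp.pos _) _ _ hdeg,
    Polynomial.coeff_map]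
  rfl

end Ghost

/-! ### Chain rule and homogeneity. -/

theorem MvPolynomial.pderiv_expand {σ R : Type*} [CommSemiring R] (q : ℕ) (i : σ)
    (f : MvPolynomial σ R) :
    pderiv i (expand q f) = (q : MvPolynomial σ R) * X i ^ (q - 1) * expand q (pderiv i f) := by
  classical
  induction f using MvPolynomial.induction_on with
  | C a => simp
  | add f g hf hg => simp only [map_add, hf, hg, mul_add]
  | mul_X f j hf =>
    simp only [map_mul, expand_X, Derivation.leibniz, hf, smul_eq_mul, map_add, Derivation.leibniz_pow,
      pderiv_X, nsmul_eq_mul]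
    by_cases h : i = j
    · subst h
      simp
      ring
    · simp [Pi.single_eq_of_ne' h]
      ring

/-- With `t` as variable `0` and `N = (p^s - 1)/2`, the form has total degree `3N`; the coefficient
of `t^(2N)` keeps degree `N` in `z`. -/
theorem approxPoly_isHomogeneous {p : ℕ} (hodd : Odd p) (s : ℕ) :
    (approxPoly p s).IsHomogeneous ((p ^ s - 1) / 2) := by
  have h : ((∏ i : Fin 3, (MvPolynomial.X 0 - MvPolynomial.X i.succ) :
      MvPolynomial (Fin 4) ℤ) ^ ((p ^ s - 1) / 2)).IsHomogeneous (3 * ((p ^ s - 1) / 2)) := by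
    refine MvPolynomial.IsHomogeneous.pow ?_ _
    have := MvPolynomial.IsHomogeneous.prod (Finset.univ : Finset (Fin 3))
      (fun i => (MvPolynomial.X 0 - MvPolynomial.X i.succ : MvPolynomial (Fin 4) ℤ)) (fun _ => 1)
      (fun i _ => (MvPolynomial.isHomogeneous_X _ _).sub (MvPolynomial.isHomogeneous_X _ _))
    simpa using this
  have h2 := h.finSuccEquiv_coeff_isHomogeneous (p ^ s - 1) ((p ^ s - 1) / 2) (by
    have := two_mul_exponent_add_one hodd s
    omega)
  simp only [map_pow, map_prod, map_sub, MvPolynomial.finSuccEquiv_X_zero,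
    MvPolynomial.finSuccEquiv_X_succ] at h2
  exact h2


/-! ### Values on the domain: the `T_s` are units. -/

section Values

variable {p : ℕ} [Fact p.Prime]

/-- The value `T_s(z)` at a `p`-adic point. -/
noncomputable def approxVal (p : ℕ) [Fact p.Prime] (s : ℕ) (z : Fin 3 → ℤ_[p]) : ℤ_[p] :=
  MvPolynomial.aeval z (approxPoly p s)

/-- The value of `∂T_s/∂zᵢ` at a `p`-adic point. -/
noncomputable def approxDerivVal (p : ℕ) [Fact p.Prime] (i : Fin 3) (s : ℕ)
    (z : Fin 3 → ℤ_[p]) : ℤ_[p] :=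
  MvPolynomial.aeval z (MvPolynomial.pderiv i (approxPoly p s))

theorem approxVal_zero (z : Fin 3 → ℤ_[p]) : approxVal p 0 z = 1 := by
  simp [approxVal, approxPoly_zero]

theorem approxVal_succ (hodd : Odd p) (s : ℕ) (z : Fin 3 → ℤ_[p]) : approxVal p (s + 1) z =
    ∑ k ∈ Finset.range (s + 1),
      MvPolynomial.aeval z (ghostCoeff p k) * approxVal p (s - k) (z ^ p ^ (k + 1)) := by
  simp [approxVal, approxPoly_succ Fact.out hodd]

theorem approxDerivVal_succ (hodd : Odd p) (i : Fin 3) (s : ℕ) (z : Fin 3 → ℤ_[p]) :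
    approxDerivVal p i (s + 1) z = ∑ k ∈ Finset.range (s + 1),
      (MvPolynomial.aeval z (MvPolynomial.pderiv i (ghostCoeff p k)) *
          approxVal p (s - k) (z ^ p ^ (k + 1)) +
        MvPolynomial.aeval z (ghostCoeff p k) * (p ^ (k + 1) * z i ^ (p ^ (k + 1) - 1)) *
          approxDerivVal p i (s - k) (z ^ p ^ (k + 1))) := by
  simp only [approxDerivVal, approxVal, approxPoly_succ Fact.out hodd, map_sum, Derivation.leibniz,
    MvPolynomial.pderiv_expand, smul_eq_mul, map_add, map_mul, map_pow, map_natCast, Nat.cast_pow,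
    MvPolynomial.aeval_X, MvPolynomial.aeval_expand]
  exact Finset.sum_congr rfl fun k _ => by ring

theorem pow_dvd_aeval_ghostCoeff (hodd : Odd p) (k : ℕ) (z : Fin 3 → ℤ_[p]) :
    (p : ℤ_[p]) ^ k ∣ MvPolynomial.aeval z (ghostCoeff p k) := by
  simpa using map_dvd (MvPolynomial.aeval z) (pow_dvd_ghostCoeff Fact.out hodd k)

theorem pow_dvd_aeval_pderiv_ghostCoeff (hodd : Odd p) (i : Fin 3) (k : ℕ)
    (z : Fin 3 → ℤ_[p]) :
    (p : ℤ_[p]) ^ k ∣ MvPolynomial.aeval z (MvPolynomial.pderiv i (ghostCoeff p k)) := by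
  obtain ⟨g, hg⟩ := pow_dvd_ghostCoeff (Fact.out : p.Prime) hodd k
  have h : (p : MvPolynomial (Fin 3) ℤ) ^ k = MvPolynomial.C ((p : ℤ) ^ k) := by simp
  rw [hg, h, MvPolynomial.pderiv_C_mul, ← h, map_mul, map_pow, map_natCast]
  exact dvd_mul_right _ _

theorem mem_domainD_iff {z : Fin 3 → ℤ_[p]} : z ∈ domainD p ↔ IsUnit (approxVal p 1 z) := by
  rw [domainD, Set.mem_ofPred_eq, PadicInt.isUnit_iff, approxVal, approxPolyBar, map_mul, norm_mul]
  simp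

theorem PadicInt.isUnit_iff_toZMod_ne_zero {x : ℤ_[p]} :
    IsUnit x ↔ PadicInt.toZMod x ≠ 0 := by
  rw [ne_eq, ← RingHom.mem_ker, PadicInt.ker_toZMod, IsLocalRing.mem_maximalIdeal, mem_nonunits_iff,
    not_not]

/-- Membership depends only on `z` modulo `p`, which Frobenius fixes by Fermat. -/
theorem pow_mem_domainD {z : Fin 3 → ℤ_[p]} (hz : z ∈ domainD p) (k : ℕ) :
    z ^ p ^ k ∈ domainD p := by
  rw [mem_domainD_iff, PadicInt.isUnit_iff_toZMod_ne_zero] at hz ⊢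
  have key : ∀ w : Fin 3 → ℤ_[p], PadicInt.toZMod (approxVal p 1 w) =
      MvPolynomial.eval₂ (Int.castRingHom (ZMod p)) (fun i => PadicInt.toZMod (w i))
        (approxPoly p 1) := by
    intro w
    rw [approxVal, MvPolynomial.aeval_def, MvPolynomial.eval₂_comp_left]
    congr 1
    exact RingHom.ext_int _ _
  rw [key] at hz ⊢
  simpa [ZMod.pow_card_pow] using hz

theorem isUnit_approxVal (hodd : Odd p) (s : ℕ) {z : Fin 3 → ℤ_[p]} (hz : z ∈ domainD p) :
    IsUnit (approxVal p s z) := by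
  induction s generalizing z with
  | zero => simp [approxVal_zero]
  | succ s ih =>
    by_contra hcon
    -- Splitting off `k = 0` gives `T_{s+1}(z) ≡ T_1(z) T_s(z^p)` modulo `p`.
    rw [← mem_nonunits_iff, PadicInt.mem_nonunits, PadicInt.norm_lt_one_iff_dvd,
      approxVal_succ hodd, Finset.sum_range_succ', dvd_add_right] at hcon
    · have h1 := approxVal_succ hodd 0 z
      simp only [zero_add, Finset.sum_range_one, Nat.sub_self, approxVal_zero, mul_one] at h1
      rw [← h1, ← PadicInt.norm_lt_one_iff_dvd, ← PadicInt.mem_nonunits] at hcon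
      exact hcon ((mem_domainD_iff.1 hz).mul (ih (pow_mem_domainD hz _)))
    · exact Finset.dvd_sum fun k _ => (((dvd_pow_self _ k.succ_ne_zero).trans
        (pow_dvd_aeval_ghostCoeff hodd _ z))).mul_right _

/-! ### Dwork congruences for the ratios. -/

/-- The ratio `T_s(z ^ p ^ k) / T_{s+k}(z)`. -/
noncomputable def approxRatio (p : ℕ) [Fact p.Prime] (s k : ℕ) (z : Fin 3 → ℤ_[p]) : ℤ_[p] :=
  approxVal p s (z ^ p ^ k) * Ring.inverse (approxVal p (s + k) z)

theorem approxRatio_mul (hodd : Odd p) (s k : ℕ) {z : Fin 3 → ℤ_[p]} (hz : z ∈ domainD p) :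
    approxRatio p s k z * approxVal p (s + k) z = approxVal p s (z ^ p ^ k) :=
  Ring.inverse_mul_cancel_right _ _ (isUnit_approxVal hodd _ hz)

theorem approxRatio_zero (hodd : Odd p) (s : ℕ) {z : Fin 3 → ℤ_[p]} (hz : z ∈ domainD p) :
    approxRatio p s 0 z = 1 := by
  simpa [approxRatio] using Ring.mul_inverse_cancel _ (isUnit_approxVal hodd s hz)

theorem approxRatio_succ (hodd : Odd p) (s k : ℕ) {z : Fin 3 → ℤ_[p]} (hz : z ∈ domainD p) :
    approxRatio p s (k + 1) z = approxRatio p s k (z ^ p) * approxRatio p (s + k) 1 z := by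
  have hzp : z ^ p ∈ domainD p := by simpa using pow_mem_domainD hz 1
  rw [← (isUnit_approxVal hodd (s + (k + 1)) hz).mul_left_inj, approxRatio_mul hodd _ _ hz, mul_assoc,
    ← add_assoc, approxRatio_mul hodd _ _ hz, pow_one, approxRatio_mul hodd _ _ hzp, ← pow_mul,
    ← pow_succ']

/-- The expansion of `T_{n+1}(z) / T_n(z ^ p)` in terms of ghost coefficients. -/
noncomputable def ghostSum (p : ℕ) [Fact p.Prime] (n : ℕ) (z : Fin 3 → ℤ_[p]) : ℤ_[p] :=
  ∑ k ∈ Finset.range (n + 1),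
    MvPolynomial.aeval z (ghostCoeff p k) * approxRatio p (n - k) k (z ^ p)

theorem ghostSum_mul_approxRatio (hodd : Odd p) (n : ℕ) {z : Fin 3 → ℤ_[p]}
    (hz : z ∈ domainD p) : ghostSum p n z * approxRatio p n 1 z = 1 := by
  have hzp : z ^ p ∈ domainD p := by simpa using pow_mem_domainD hz 1
  have h : ghostSum p n z * approxVal p n (z ^ p) = approxVal p (n + 1) z := by
    rw [ghostSum, approxVal_succ hodd, Finset.sum_mul]
    refine Finset.sum_congr rfl fun k hk => ?_
    have hk := Finset.mem_range.1 hk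
    have h := approxRatio_mul hodd (n - k) k hzp
    rw [Nat.sub_add_cancel (by omega)] at h
    rw [mul_assoc, h, ← pow_mul, ← pow_succ']
  have h2 := approxRatio_mul hodd n 1 hz
  rw [← h, pow_one, ← mul_assoc] at h2
  refine (isUnit_approxVal hodd n hzp).mul_left_inj.1 ?_
  rw [one_mul, mul_comm (ghostSum p n z), h2]

/-- Induction on `s + k`: the ratio factors into one with smaller `k` at `z^p` and a one-step ratio.
The latter is the inverse of `ghostSum`, whose term `j` pairs `p^j` with a ratio of index sum `s +
k` already treated. -/
theorem pow_dvd_approxRatio_sub (hodd : Odd p) (s k : ℕ) {z : Fin 3 → ℤ_[p]}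
    (hz : z ∈ domainD p) :
    (p : ℤ_[p]) ^ (s + 1) ∣ approxRatio p (s + 1) k z - approxRatio p s k z := by
  induction hN : s + k generalizing s k z with
  | zero =>
    obtain rfl : k = 0 := by omega
    simp [approxRatio_zero hodd _ hz]
  | succ N ih =>
    cases k with
    | zero => simp [approxRatio_zero hodd _ hz]
    | succ k =>
      obtain rfl : N = s + k := by omega
      have hzp : z ^ p ∈ domainD p := by simpa using pow_mem_domainD hz 1
      have hu : (p : ℤ_[p]) ^ (s + k + 1) ∣ ghostSum p (s + k + 1) z - ghostSum p (s + k) z := by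
        rw [ghostSum, Finset.sum_range_succ, add_sub_right_comm, ghostSum,
          ← Finset.sum_sub_distrib]
        refine dvd_add (Finset.dvd_sum fun j hj => ?_)
          ((pow_dvd_aeval_ghostCoeff hodd _ _).mul_right _)
        have hj := Finset.mem_range.1 hj
        rw [← mul_sub, show s + k + 1 = j + (s + k - j + 1) by omega, pow_add,
          show j + (s + k - j + 1) - j = s + k - j + 1 by omega]
        exact mul_dvd_mul (pow_dvd_aeval_ghostCoeff hodd _ _) (ih _ _ hzp (by omega))
      have h1 := ghostSum_mul_approxRatio hodd (s + k) hz
      have h2 := ghostSum_mul_approxRatio hodd (s + k + 1) hz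
      have hv : (p : ℤ_[p]) ^ (s + 1) ∣
          approxRatio p (s + k + 1) 1 z - approxRatio p (s + k) 1 z := by
        -- Difference of two inverses: `1/a - 1/b = (b - a)/(ab)`.
        have e : approxRatio p (s + k + 1) 1 z - approxRatio p (s + k) 1 z =
            (ghostSum p (s + k + 1) z - ghostSum p (s + k) z) *
              -(approxRatio p (s + k) 1 z * approxRatio p (s + k + 1) 1 z) := by
          linear_combination approxRatio p (s + k) 1 z * h2 - approxRatio p (s + k + 1) 1 z * h1
        rw [e]
        exact ((pow_dvd_pow _ (by omega)).trans hu).mul_right _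
      rw [approxRatio_succ hodd (s + 1) k hz, approxRatio_succ hodd s k hz, add_right_comm s 1 k]
      have e : ∀ a b c d : ℤ_[p], a * b - c * d = (a - c) * b + c * (b - d) := fun _ _ _ _ => by ring
      rw [e]
      exact dvd_add ((ih s k hzp rfl).mul_right _) (hv.mul_left _)

/-! ### Congruences for the logarithmic derivatives. -/

/-- The logarithmic derivative `η_s^{(i)}(z)` as a `p`-adic integer. -/
noncomputable def etaInt (p : ℕ) [Fact p.Prime] (i : Fin 3) (s : ℕ) (z : Fin 3 → ℤ_[p]) : ℤ_[p] :=
  approxDerivVal p i s z * Ring.inverse (approxVal p s z)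

theorem etaInt_mul (hodd : Odd p) (i : Fin 3) (s : ℕ) {z : Fin 3 → ℤ_[p]} (hz : z ∈ domainD p) :
    etaInt p i s z * approxVal p s z = approxDerivVal p i s z :=
  Ring.inverse_mul_cancel_right _ _ (isUnit_approxVal hodd _ hz)

theorem etaInt_succ (hodd : Odd p) (i : Fin 3) (s : ℕ) {z : Fin 3 → ℤ_[p]} (hz : z ∈ domainD p) :
    etaInt p i (s + 1) z = ∑ k ∈ Finset.range (s + 1),
      (MvPolynomial.aeval z (MvPolynomial.pderiv i (ghostCoeff p k)) *
          approxRatio p (s - k) (k + 1) z +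
        MvPolynomial.aeval z (ghostCoeff p k) * (p ^ (k + 1) * z i ^ (p ^ (k + 1) - 1)) *
          (etaInt p i (s - k) (z ^ p ^ (k + 1)) * approxRatio p (s - k) (k + 1) z)) := by
  rw [← (isUnit_approxVal hodd (s + 1) hz).mul_left_inj, etaInt_mul hodd _ _ hz,
    approxDerivVal_succ hodd, Finset.sum_mul]
  refine Finset.sum_congr rfl fun k hk => ?_
  have hk := Finset.mem_range.1 hk
  have h := approxRatio_mul hodd (s - k) (k + 1) hz
  rw [show s - k + (k + 1) = s + 1 by omega] at h
  rw [← etaInt_mul hodd i (s - k) (pow_mem_domainD hz (k + 1)), ← h]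
  ring

theorem pow_dvd_etaInt_sub (hodd : Odd p) (i : Fin 3) (s : ℕ) {z : Fin 3 → ℤ_[p]}
    (hz : z ∈ domainD p) :
    (p : ℤ_[p]) ^ s ∣ etaInt p i (s + 1) z - etaInt p i s z := by
  induction s using Nat.strong_induction_on generalizing z with
  | _ s ih =>
    cases s with
    | zero => simp
    | succ s =>
      rw [etaInt_succ hodd i (s + 1) hz, Finset.sum_range_succ, add_sub_right_comm,
        etaInt_succ hodd i s hz, ← Finset.sum_sub_distrib]
      refine dvd_add (Finset.dvd_sum fun k hk => ?_) (dvd_add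
        ((pow_dvd_aeval_pderiv_ghostCoeff hodd _ _ _).mul_right _)
        (((pow_dvd_aeval_ghostCoeff hodd _ _).mul_right _).mul_right _))
      obtain ⟨m, rfl⟩ := Nat.exists_eq_add_of_le (Nat.lt_succ_iff.1 (Finset.mem_range.1 hk))
      rw [show k + m + 1 - k = m + 1 by omega, show k + m - k = m by omega, add_sub_add_comm,
        ← mul_sub, ← mul_sub]
      have hr := pow_dvd_approxRatio_sub hodd m (k + 1) hz
      have he := ih m (by omega) (pow_mem_domainD hz (k + 1))
      refine dvd_add ?_ ?_
      · rw [add_assoc, pow_add]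
        exact mul_dvd_mul (pow_dvd_aeval_pderiv_ghostCoeff hodd i k z) hr
      -- The chain-rule factor `p^(k+1)` makes up for `η` being controlled only modulo `p^m`.
      · have e : ∀ a b c d : ℤ_[p], a * b - c * d = (a - c) * b + c * (b - d) :=
          fun _ _ _ _ => by ring
        rw [e, show k + m + 1 = k + 1 + m by ring, pow_add]
        exact mul_dvd_mul (((Dvd.intro _ rfl).mul_left _))
          (dvd_add (he.mul_right _) (((pow_dvd_pow _ m.le_succ).trans hr).mul_left _))

theorem coe_etaInt (hodd : Odd p) (i : Fin 3) (s : ℕ) {z : Fin 3 → ℤ_[p]} (hz : z ∈ domainD p) :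
    (etaInt p i s z : ℚ_[p]) = etaApprox p s i z := by
  have h0 : (approxVal p s z : ℚ_[p]) ≠ 0 := by
    rw [PadicInt.coe_ne_zero]
    exact (isUnit_approxVal hodd s hz).ne_zero
  refine (eq_div_iff h0).2 ?_
  rw [← PadicInt.coe_mul, etaInt_mul hodd i s hz]
  rfl

theorem sum_mul_etaInt (hodd : Odd p) (s : ℕ) {z : Fin 3 → ℤ_[p]} (hz : z ∈ domainD p) :
    2 * ∑ i, z i * etaInt p i s z = (p : ℤ_[p]) ^ s - 1 := by
  have h := congrArg (MvPolynomial.aeval z) (approxPoly_isHomogeneous hodd s).sum_X_mul_pderiv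
  simp only [map_sum, map_mul, MvPolynomial.aeval_X, map_nsmul] at h
  rw [← (isUnit_approxVal hodd s hz).mul_left_inj, mul_assoc, Finset.sum_mul]
  simp only [mul_assoc, etaInt_mul hodd _ _ hz]
  simp only [approxDerivVal]
  have h2 : (2 * (((p ^ s - 1) / 2 : ℕ) : ℤ_[p]) + 1) = (p : ℤ_[p]) ^ s := by
    exact_mod_cast congrArg (Nat.cast : ℕ → ℤ_[p]) (two_mul_exponent_add_one hodd s)
  rw [h, nsmul_eq_mul, ← h2, approxVal]
  ring

/-! ### Uniform convergence and nonvanishing of the limit. -/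

theorem dist_etaApprox_succ_le (hodd : Odd p) (i : Fin 3) (s : ℕ) {z : Fin 3 → ℤ_[p]}
    (hz : z ∈ domainD p) :
    dist (etaApprox p s i z) (etaApprox p (s + 1) i z) ≤ 1 * ((p : ℝ)⁻¹) ^ s := by
  have h := (PadicInt.norm_le_pow_iff_mem_span_pow _ s).2
    (Ideal.mem_span_singleton.2 (pow_dvd_etaInt_sub hodd i s hz))
  rw [dist_comm, dist_eq_norm, ← coe_etaInt hodd i _ hz, ← coe_etaInt hodd i _ hz,
    ← PadicInt.coe_sub, ← PadicInt.norm_def, one_mul]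
  simpa using h

/-- Geometric Cauchy bounds in the complete field `ℚ_[p]` make the `limUnder` in `etaVec` a genuine
limit on `𝔇`. -/
theorem tendsto_etaApprox (hodd : Odd p) (i : Fin 3) {z : Fin 3 → ℤ_[p]} (hz : z ∈ domainD p) :
    Tendsto (fun s => etaApprox p s i z) atTop (𝓝 (etaVec p z i)) :=
  (cauchySeq_of_le_geometric _ 1 (inv_lt_one_of_one_lt₀
    (by exact_mod_cast (Fact.out : p.Prime).one_lt))
    fun s => dist_etaApprox_succ_le hodd i s hz).tendsto_limUnder

theorem tendstoUniformlyOn_etaApprox (hodd : Odd p) (i : Fin 3) :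
    TendstoUniformlyOn (fun (s : ℕ) (z : Fin 3 → ℤ_[p]) => etaApprox p s i z)
      (fun z => etaVec p z i) atTop (domainD p) := by
  have hlt : (p : ℝ)⁻¹ < 1 := inv_lt_one_of_one_lt₀
    (by exact_mod_cast (Fact.out : p.Prime).one_lt)
  rw [Metric.tendstoUniformlyOn_iff]
  intro ε hε
  have hlim : Tendsto (fun s : ℕ => 1 * (p : ℝ)⁻¹ ^ s / (1 - (p : ℝ)⁻¹)) atTop (𝓝 0) := by
    simpa using ((tendsto_pow_atTop_nhds_zero_of_lt_one (by positivity) hlt).const_mul 1).div_const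
      (1 - (p : ℝ)⁻¹)
  filter_upwards [hlim.eventually (gt_mem_nhds hε)] with s hs z hz
  rw [dist_comm]
  exact (dist_le_of_le_geometric_of_tendsto _ _ hlt (fun s => dist_etaApprox_succ_le hodd i s hz)
    (tendsto_etaApprox hodd i hz) s).trans_lt hs

theorem two_mul_sum_mul_etaVec (hodd : Odd p) {z : Fin 3 → ℤ_[p]} (hz : z ∈ domainD p) :
    2 * ∑ i, (z i : ℚ_[p]) * etaVec p z i = -1 := by
  have h1 : Tendsto (fun s => 2 * ∑ i, (z i : ℚ_[p]) * etaApprox p s i z) atTop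
      (𝓝 (2 * ∑ i, (z i : ℚ_[p]) * etaVec p z i)) :=
    (tendsto_finsetSum _ fun i _ => (tendsto_etaApprox hodd i hz).const_mul _).const_mul _
  have h2 : Tendsto (fun s : ℕ => (p : ℚ_[p]) ^ s - 1) atTop (𝓝 (0 - 1)) :=
    (tendsto_pow_atTop_nhds_zero_of_norm_lt_one Padic.norm_p_lt_one).sub_const 1
  rw [zero_sub] at h2
  refine tendsto_nhds_unique h1 (h2.congr fun s => ?_)
  simp only [← coe_etaInt hodd _ s hz]
  exact_mod_cast (congrArg ((↑) : ℤ_[p] → ℚ_[p]) (sum_mul_etaInt hodd s hz)).symm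

end Values

theorem mainTheorem11 (p : ℕ) [Fact p.Prime] (hp : p ≠ 2) :
    (∀ s : ℕ, 1 ≤ s → ∀ z ∈ domainD p,
      (MvPolynomial.aeval z (approxPoly p s) : ℤ_[p]) ≠ 0) ∧
    (∀ i : Fin 3, TendstoUniformlyOn (fun (s : ℕ) (z : Fin 3 → ℤ_[p]) => etaApprox p s i z)
      (fun z => etaVec p z i) atTop (domainD p)) ∧
    (∀ z ∈ domainD p, etaVec p z ≠ 0) := by
  have hodd : Odd p := (Fact.out : p.Prime).odd_of_ne_two hp
  refine ⟨fun s _ z hz => (isUnit_approxVal hodd s hz).ne_zero,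
    fun i => tendstoUniformlyOn_etaApprox hodd i, fun z hz h0 => ?_⟩
  have h := two_mul_sum_mul_etaVec hodd hz
  simp [h0] at h
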